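/- For an integer $t\ge 0$ let $$\mathcal{U}_{2t}(2;q):=\sum_{1\le k_1<\cdots<k_t}\ \prod_{i=1}^{t}\frac{q^{k_i}}{1+2q^{k_i}+q^{2k_i}}=\sum_{1\le k_1<\cdots<k_t}\frac{q^{k_1+\cdots+k_t}}{(1+q^{k_1})^2\cdots(1+q^{k_t})^2}\in\mathbb{Z}[[q]],$$ where $k_1,\dots,k_t$ are integers and $\mathcal{U}_0(2;q)=1$. These sums, and the sum $\sum_{t\ge0}\mathcal{U}_{2t}(2;q)$, converge coefficientwise as formal power series. Define integers $y(n)$ by $\sum_{n\ge0}y(n)\,q^n:=\sum_{t\ge0}\mathcal{U}_{2t}(2;q)$. Then, for every integer $n\ge0$, $$y(n)\equiv(-1)^n\cdot\#\{(r,s)\in\mathbb{Z}^2:\ n=r^2+s^2\}\pmod 5.$$ -/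

import Mathlib

open scoped PowerSeries PowerSeries.WithPiTopology

namespace MacMahonSums

/-- The formal power series `1 + a q^k + q^(2k)` with integer coefficients, for `k ≥ 1`. -/
noncomputable def denom (a : ℤ) (k : ℕ+) : ℤ⟦X⟧ :=
  1 + PowerSeries.C a * PowerSeries.X ^ (k : ℕ) + PowerSeries.X ^ (2 * (k : ℕ))

/-- The quotient `q^k / (1 + a q^k + q^(2k))` in the ring of formal power series over `ℤ`. -/
noncomputable def factor (a : ℤ) (k : ℕ+) : ℤ⟦X⟧ :=
  PowerSeries.X ^ (k : ℕ) * PowerSeries.invOfUnit (denom a k) 1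

/-- `factor a k` is the quotient that it is meant to be: the denominator has constant
coefficient `1`. -/
theorem factor_mul_denom (a : ℤ) (k : ℕ+) :
    factor a k * denom a k = PowerSeries.X ^ (k : ℕ) := by
  have h : PowerSeries.constantCoeff (denom a k) = ((1 : ℤˣ) : ℤ) := by
    simp [denom, k.ne_zero]
  rw [factor, mul_assoc, PowerSeries.invOfUnit_mul _ _ h, mul_one]

/-- For a finite set `S = {k₁ < ⋯ < k_t}` of positive integers, the summand
`q^(k₁ + ⋯ + k_t) / ((1 + a q^k₁ + q^(2k₁)) ⋯ (1 + a q^k_t + q^(2k_t)))`. -/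
noncomputable def summand (a : ℤ) (S : Finset ℕ+) : ℤ⟦X⟧ :=
  ∏ k ∈ S, factor a k

/-- The MacMahon-type series `𝒰_{2t}(a; q)`: the sum over all `1 ≤ k₁ < ⋯ < k_t` (that is, over
all `t`-element sets of positive integers) of
`q^(k₁ + ⋯ + k_t) / ((1 + a q^k₁ + q^(2k₁)) ⋯ (1 + a q^k_t + q^(2k_t)))`,
where the infinite sum converges coefficientwise. The case `a = -2` is MacMahon's `𝒰_{2t}(q)`. -/
noncomputable def U (a : ℤ) (t : ℕ) : ℤ⟦X⟧ :=
  ∑' S : {S : Finset ℕ+ // S.card = t}, summand a S.1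

end MacMahonSums

/-! ### The sum over all `t` as an infinite product. -/

namespace MacMahonSums

open Filter Topology

/-! Summing over all finite sets of positive integers gives `∏ (1 + q^k/(1+q^k)^2)`
(`hasProd_one_add_factor`). Its factors are `(1+3q^k+q^(2k))/(1+q^k)^2`, and `3 ≡ -2` modulo 5, so
the product is congruent to `∏ ((1-q^k)/(1+q^k))^2`. By Gauss this is the square of `∑ (-1)^j
q^(j^2)`, whose coefficients are the signed counts of representations by two squares.

Gauss' identity comes from a finite form (`finsum_term_mul_evenProd`), proved by induction from a
recurrence in `n` and then truncated modulo `q^(2n+1)`, so that only finite products and sums over a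
field enter. -/

theorem le_order_factor (a : ℤ) (k : ℕ+) : ((k : ℕ) : ℕ∞) ≤ (factor a k).order := by
  rw [factor]
  refine le_trans ?_ (PowerSeries.le_order_mul _ _)
  rw [PowerSeries.order_X_pow]
  exact le_self_add

theorem tendsto_order_factor (a : ℤ) :
    Tendsto (fun k => (factor a k).order) atTop (𝓝 ⊤) := by
  refine ENat.tendsto_nhds_top_iff_natCast_lt.mpr fun n =>
    eventually_atTop.mpr ⟨n.succPNat, fun k hk => ?_⟩
  refine lt_of_lt_of_le ?_ (le_order_factor a k)
  have : n + 1 ≤ (k : ℕ) := by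
    have := PNat.coe_le_coe _ _ |>.mpr hk
    simpa using this
  exact_mod_cast this

theorem summable_summand (a : ℤ) : Summable (summand a) :=
  PowerSeries.WithPiTopology.summable_prod_of_tendsto_order_atTop_nhds_top ℤ
    (tendsto_order_factor a)

theorem summable_summand_card (a : ℤ) (t : ℕ) :
    Summable fun S : {S : Finset ℕ+ // S.card = t} => summand a S.1 :=
  (summable_summand a).comp_injective Subtype.val_injective

/-- Summability over all finite sets permits grouping them by cardinality. -/
theorem hasSum_U (a : ℤ) : HasSum (U a) (∑' S, summand a S) :=
  (summable_summand a).hasSum.tsum_fiberwise Finset.card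

theorem hasProd_one_add_factor (a : ℤ) :
    HasProd (fun k => 1 + factor a k) (∑' S, summand a S) :=
  hasProd_one_add_of_hasSum_prod (summable_summand a).hasSum

/-- The set `{1, …, n}` of positive integers. -/
def initialSegment (n : ℕ) : Finset ℕ+ := (Finset.range n).map ⟨Nat.succPNat, Nat.succPNat_injective⟩

theorem tendsto_initialSegment : Tendsto initialSegment atTop atTop := by
  refine tendsto_atTop_finset_of_monotone
    (fun m n h => Finset.map_subset_map.mpr (Finset.range_mono h)) fun k => ⟨k, ?_⟩
  simp only [initialSegment, Finset.mem_map, Finset.mem_range, Function.Embedding.coeFn_mk]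
  exact ⟨k.natPred, by simp [PNat.natPred, k.pos], by simp⟩

theorem eventually_coeff_prod_one_add_factor (a : ℤ) (d : ℕ) :
    ∀ᶠ n in atTop, PowerSeries.coeff d (∏ i ∈ Finset.range n, (1 + factor a i.succPNat)) =
      PowerSeries.coeff d (∑' S, summand a S) := by
  have h := (PowerSeries.WithPiTopology.tendsto_iff_coeff_tendsto ℤ _ _ _).mp
    ((hasProd_one_add_factor a).comp tendsto_initialSegment) d
  rw [nhds_discrete, tendsto_pure] at h
  simpa [initialSegment] using h

end MacMahonSums

/-! ### The finite form of Gauss' identity. -/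

namespace GaussSquare

open PowerSeries

variable (K : Type*) [Field K]

/-- The finite product `(q²; q²)_n`. -/
noncomputable def evenProd (n : ℕ) : K⟦X⟧ := ∏ i ∈ Finset.range n, (1 - X ^ (2 * (i + 1)))

/-- The finite product `(q; q²)_n`. -/
noncomputable def oddProd (n : ℕ) : K⟦X⟧ := ∏ i ∈ Finset.range n, (1 - X ^ (2 * i + 1))

/-- The finite product `(q; q)_n`. -/
noncomputable def fullProd (n : ℕ) : K⟦X⟧ := ∏ i ∈ Finset.range n, (1 - X ^ (i + 1))

/-- The finite product `(-q; q)_n`. -/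
noncomputable def plusProd (n : ℕ) : K⟦X⟧ := ∏ i ∈ Finset.range n, (1 + X ^ (i + 1))

variable {K}

theorem constantCoeff_evenProd (n : ℕ) : constantCoeff (evenProd K n) = 1 := by
  simp [evenProd, map_prod]

theorem constantCoeff_plusProd (n : ℕ) : constantCoeff (plusProd K n) = 1 := by
  simp [plusProd, map_prod]

theorem evenProd_ne_zero (n : ℕ) : evenProd K n ≠ 0 := fun h => by
  simpa [h] using constantCoeff_evenProd (K := K) n

theorem evenProd_mul_inv (n : ℕ) : evenProd K n * (evenProd K n)⁻¹ = 1 :=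
  PowerSeries.mul_inv_cancel _ (by simp [constantCoeff_evenProd])

theorem fullProd_mul_plusProd (n : ℕ) : fullProd K n * plusProd K n = evenProd K n := by
  rw [fullProd, plusProd, evenProd, ← Finset.prod_mul_distrib]
  exact Finset.prod_congr rfl fun i _ => by ring

theorem evenProd_mul_oddProd (n : ℕ) : evenProd K n * oddProd K n = fullProd K (2 * n) := by
  induction n with
  | zero => simp [evenProd, oddProd, fullProd]
  | succ n ih =>
    rw [show 2 * (n + 1) = 2 * n + 1 + 1 by ring, fullProd, Finset.prod_range_succ,
      Finset.prod_range_succ, ← fullProd, ← ih, evenProd, oddProd, Finset.prod_range_succ,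
      Finset.prod_range_succ, ← evenProd, ← oddProd]
    ring

variable (K) in
/-- The reciprocal of `(q²; q²)_m`, extended by zero to negative `m`. -/
noncomputable def invEven : ℤ → K⟦X⟧
  | Int.ofNat m => (evenProd K m)⁻¹
  | Int.negSucc _ => 0

theorem invEven_natCast (m : ℕ) : invEven K m = (evenProd K m)⁻¹ := rfl

theorem invEven_of_neg {m : ℤ} (h : m < 0) : invEven K m = 0 := by
  obtain ⟨k, rfl⟩ := Int.exists_eq_neg_ofNat h.le
  cases k with
  | zero => simp at h
  | succ k => rfl

theorem invEven_natCast_eq (m : ℕ) :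
    invEven K m = (1 - X ^ (2 * (m + 1))) * invEven K (m + 1 : ℕ) := by
  refine mul_left_cancel₀ (evenProd_ne_zero (K := K) m) ?_
  rw [invEven_natCast, invEven_natCast, evenProd_mul_inv, ← mul_assoc]
  have : evenProd K m * (1 - X ^ (2 * (m + 1))) = evenProd K (m + 1) := by
    rw [evenProd, evenProd, Finset.prod_range_succ]
  rw [this, evenProd_mul_inv]

variable (K) in
/-- The `j`-th term of the finite form of Gauss' theta series identity. -/
noncomputable def term (n j : ℤ) : K⟦X⟧ :=
  (-1) ^ j.natAbs * X ^ (j.natAbs ^ 2) * (invEven K (n + j) * invEven K (n - j))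

theorem term_eq_zero {n j : ℤ} (h : j ∉ Set.Icc (-n) n) : term K n j = 0 := by
  rw [Set.mem_Icc, not_and_or] at h
  rw [term]
  rcases h with h | h
  · rw [invEven_of_neg (by lia : n + j < 0)]; ring
  · rw [invEven_of_neg (by lia : n - j < 0)]; ring

theorem term_hasFiniteSupport (n : ℤ) : (term K n).HasFiniteSupport :=
  (Set.finite_Icc (-n) n).subset fun j hj => by
    by_contra h
    exact hj (term_eq_zero h)

theorem neg_one_pow_natAbs_add_one (j : ℤ) :
    (-1 : K⟦X⟧) ^ (j + 1).natAbs = -(-1) ^ j.natAbs := by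
  rcases Nat.even_or_odd j.natAbs with h | h
  · rw [h.neg_one_pow, Odd.neg_one_pow]
    rw [Int.natAbs_odd]; exact (Int.natAbs_even.mp h).add_one
  · rw [h.neg_one_pow, Even.neg_one_pow]
    · simp
    rw [Int.natAbs_even]; exact (Int.natAbs_odd.mp h).add_one

theorem neg_one_pow_natAbs_sub_one (j : ℤ) :
    (-1 : K⟦X⟧) ^ (j - 1).natAbs = -(-1) ^ j.natAbs := by
  have := neg_one_pow_natAbs_add_one (K := K) (j - 1)
  rw [sub_add_cancel] at this
  rw [this, neg_neg]

theorem X_pow_mul_sq_natAbs_sub_one {n : ℕ} {j : ℤ} {b : ℕ} (hb : (b : ℤ) = n + 1 - j) :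
    (X : K⟦X⟧) ^ (2 * n + 1) * X ^ ((j - 1).natAbs ^ 2) = X ^ (j.natAbs ^ 2) * X ^ (2 * b) := by
  rw [← pow_add, ← pow_add]
  congr 1
  zify
  rw [sq_abs, sq_abs, hb]
  ring

theorem X_pow_mul_sq_natAbs_add_one {n : ℕ} {j : ℤ} {a : ℕ} (ha : (a : ℤ) = n + 1 + j) :
    (X : K⟦X⟧) ^ (2 * n + 1) * X ^ ((j + 1).natAbs ^ 2) = X ^ (j.natAbs ^ 2) * X ^ (2 * a) := by
  rw [← pow_add, ← pow_add]
  congr 1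
  zify
  rw [sq_abs, sq_abs, ha]
  ring

/-- The contiguity relation for the products `invEven a * invEven b`. -/
theorem invEven_contiguous (n a b : ℕ) (hab : a + b = 2 * n + 2) :
    invEven K a * invEven K b * ((1 - X ^ (2 * (2 * n + 1))) * (1 - X ^ (2 * (2 * n + 2)))) =
      (1 + X ^ (2 * (2 * n + 1))) * (invEven K (a - 1) * invEven K (b - 1)) +
      X ^ (2 * b) * (invEven K (a - 2) * invEven K b) +
      X ^ (2 * a) * (invEven K a * invEven K (b - 2)) := by
  have hb2 : ∀ c : ℕ, invEven K ((c + 2 : ℕ) - 1 : ℤ) =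
      (1 - X ^ (2 * (c + 2))) * invEven K (c + 2 : ℕ) := fun c => by
    have := invEven_natCast_eq (K := K) (c + 1)
    rw [← this]; congr 1; push_cast; ring
  have hb1 : ∀ c : ℕ, invEven K ((c + 2 : ℕ) - 2 : ℤ) =
      (1 - X ^ (2 * (c + 1))) * ((1 - X ^ (2 * (c + 2))) * invEven K (c + 2 : ℕ)) := fun c => by
    rw [← invEven_natCast_eq (c + 1), ← invEven_natCast_eq c]; congr 1; push_cast; ring
  have h1 : invEven K (0 : ℕ) = (1 - X ^ 2) * invEven K (1 : ℕ) := invEven_natCast_eq 0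
  -- For `a, b ≥ 2` every term is a polynomial multiple of `invEven K a * invEven K b`, which leaves
  -- a polynomial identity. Smaller indices are separate because `invEven` is zero at negative
  -- arguments.
  match a, b with
  | 0, 0 => lia
  | 0, 1 => lia
  | 1, 0 => lia
  | 0, b + 2 =>
    obtain rfl : b = 2 * n := by lia
    rw [hb1, invEven_of_neg (by simp : ((0 : ℕ) - 1 : ℤ) < 0),
      invEven_of_neg (by simp : ((0 : ℕ) - 2 : ℤ) < 0)]
    ring
  | a + 2, 0 =>
    obtain rfl : a = 2 * n := by lia
    rw [hb1, invEven_of_neg (by simp : ((0 : ℕ) - 1 : ℤ) < 0),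
      invEven_of_neg (by simp : ((0 : ℕ) - 2 : ℤ) < 0)]
    ring
  | 1, 1 =>
    obtain rfl : n = 0 := by lia
    rw [invEven_of_neg (by simp : ((1 : ℕ) - 2 : ℤ) < 0),
      show ((1 : ℕ) - 1 : ℤ) = (0 : ℕ) by simp, h1]
    ring
  | 1, b + 2 =>
    have h : 2 * n = b + 1 := by lia
    rw [h, hb1, hb2, invEven_of_neg (by simp : ((1 : ℕ) - 2 : ℤ) < 0),
      show ((1 : ℕ) - 1 : ℤ) = (0 : ℕ) by simp, h1]
    ring
  | a + 2, 1 =>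
    have h : 2 * n = a + 1 := by lia
    rw [h, hb1, hb2, invEven_of_neg (by simp : ((1 : ℕ) - 2 : ℤ) < 0),
      show ((1 : ℕ) - 1 : ℤ) = (0 : ℕ) by simp, h1]
    ring
  | a + 2, b + 2 =>
    have h : 2 * n = a + b + 2 := by lia
    rw [h, hb1, hb1, hb2, hb2]
    ring

/-- This is contiguity with `a = n+1+j`, `b = n+1-j`. Completing the square absorbs `q^(2b)` and
`q^(2a)` into the shifts `j ∓ 1`, each of which flips the sign. -/
theorem term_succ (n : ℕ) (j : ℤ) :
    term K (n + 1 : ℕ) j * ((1 - X ^ (2 * (2 * n + 1))) * (1 - X ^ (2 * (2 * n + 2)))) =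
      (1 + X ^ (2 * (2 * n + 1))) * term K n j -
        X ^ (2 * n + 1) * term K n (j - 1) - X ^ (2 * n + 1) * term K n (j + 1) := by
  by_cases hj : j ∈ Set.Icc (-((n : ℤ) + 1)) (n + 1)
  · rw [Set.mem_Icc] at hj
    obtain ⟨a, ha⟩ := Int.eq_ofNat_of_zero_le (by lia : 0 ≤ (n : ℤ) + 1 + j)
    obtain ⟨b, hb⟩ := Int.eq_ofNat_of_zero_le (by lia : 0 ≤ (n : ℤ) + 1 - j)
    have h := invEven_contiguous (K := K) n a b (by lia)
    have h₁ := X_pow_mul_sq_natAbs_sub_one (K := K) hb.symm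
    have h₂ := X_pow_mul_sq_natAbs_add_one (K := K) ha.symm
    rw [term, term, term, term, neg_one_pow_natAbs_sub_one, neg_one_pow_natAbs_add_one,
      show ((n + 1 : ℕ) : ℤ) + j = a by push_cast; lia,
      show ((n + 1 : ℕ) : ℤ) - j = b by push_cast; lia,
      show (n : ℤ) + j = a - 1 by lia, show (n : ℤ) - j = b - 1 by lia,
      show (n : ℤ) + (j - 1) = a - 2 by lia, show (n : ℤ) - (j - 1) = b by lia,
      show (n : ℤ) + (j + 1) = a by lia, show (n : ℤ) - (j + 1) = b - 2 by lia]
    linear_combination (-1) ^ j.natAbs * X ^ (j.natAbs ^ 2) * h -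
      (-1) ^ j.natAbs * (invEven K (a - 2) * invEven K b) * h₁ -
      (-1) ^ j.natAbs * (invEven K a * invEven K (b - 2)) * h₂
  · rw [Set.mem_Icc] at hj
    rw [term_eq_zero, term_eq_zero, term_eq_zero, term_eq_zero]
    · ring
    all_goals
      rw [Set.mem_Icc]
      push_cast
      lia

theorem finsum_term_mul_evenProd (n : ℕ) :
    (∑ᶠ j, term K n j) * evenProd K (2 * n) = oddProd K n ^ 2 := by
  induction n with
  | zero =>
    rw [finsum_eq_single _ 0]
    · simp [term, oddProd, evenProd, show invEven K 0 = 1 from by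
        rw [← Int.natCast_zero, invEven_natCast]; simp [evenProd]]
    · intro j hj
      exact term_eq_zero (by simp only [Set.mem_Icc]; push_cast; lia)
  | succ n ih =>
    have hsub : ∑ᶠ j, term K n (j - 1) = ∑ᶠ j, term K n j :=
      finsum_comp_equiv (Equiv.subRight (1 : ℤ)) (f := term K n)
    have hadd : ∑ᶠ j, term K n (j + 1) = ∑ᶠ j, term K n j :=
      finsum_comp_equiv (Equiv.addRight (1 : ℤ)) (f := term K n)
    have fin := term_hasFiniteSupport (K := K) n
    have finsub : Function.HasFiniteSupport fun j => term K n (j - 1) :=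
      fin.preimage (Equiv.subRight (1 : ℤ)).injective.injOn
    have finadd : Function.HasFiniteSupport fun j => term K n (j + 1) :=
      fin.preimage (Equiv.addRight (1 : ℤ)).injective.injOn
    have finmul : ∀ (c : K⟦X⟧) {f : ℤ → K⟦X⟧}, f.HasFiniteSupport →
        Function.HasFiniteSupport fun j => c * f j := fun c f hf =>
      hf.subset fun j hj h => hj (by simp only [h, mul_zero])
    -- Shifting `j` does not change the sum, so the coefficients combine to `1 + q^(2(2n+1)) -
    -- 2q^(2n+1)`, a perfect square.
    have key : (∑ᶠ j, term K (n + 1 : ℕ) j) *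
        ((1 - X ^ (2 * (2 * n + 1))) * (1 - X ^ (2 * (2 * n + 2)))) =
        (1 - X ^ (2 * n + 1)) ^ 2 * ∑ᶠ j, term K n j := by
      rw [finsum_mul' _ _ (term_hasFiniteSupport _)]
      simp_rw [term_succ]
      have finsub₂ : Function.HasFiniteSupport fun j =>
          (1 + X ^ (2 * (2 * n + 1))) * term K n j - X ^ (2 * n + 1) * term K n (j - 1) :=
        (finmul _ fin).sub (finmul _ finsub)
      rw [finsum_sub_distrib finsub₂ (finmul _ finadd),
        finsum_sub_distrib (finmul _ fin) (finmul _ finsub), ← mul_finsum' _ _ fin,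
        ← mul_finsum' _ _ finsub, ← mul_finsum' _ _ finadd, hsub, hadd]
      ring
    rw [show 2 * (n + 1) = 2 * n + 1 + 1 by ring, evenProd, Finset.prod_range_succ,
      Finset.prod_range_succ, ← evenProd, oddProd, Finset.prod_range_succ, ← oddProd]
    linear_combination evenProd K (2 * n) * key + (1 - X ^ (2 * n + 1)) ^ 2 * ih

/-! ### Truncation to Gauss' theta series and its square. -/

variable (K) in
/-- The partial sum `∑_{|j| ≤ n} (-1)^j q^(j²)` of the theta series. -/
noncomputable def thetaSum (n : ℕ) : K⟦X⟧ :=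
  ∑ j ∈ Finset.Icc (-(n : ℤ)) n, (-1) ^ j.natAbs * X ^ (j.natAbs ^ 2)

theorem X_pow_dvd_prod_one_sub {ι : Type*} (s : Finset ι) (e : ι → ℕ) (m : ℕ)
    (h : ∀ i ∈ s, m ≤ e i) : (X : K⟦X⟧) ^ m ∣ 1 - ∏ i ∈ s, (1 - X ^ e i) := by
  induction s using Finset.cons_induction with
  | empty => simp
  | cons a s ha ih =>
    rw [Finset.prod_cons]
    have h₁ := ih fun i hi => h i (Finset.mem_cons_of_mem hi)
    have h₂ : (X : K⟦X⟧) ^ m ∣ X ^ e a := pow_dvd_pow _ (h a (Finset.mem_cons_self a s))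
    have := dvd_add h₁ (h₂.mul_right (∏ i ∈ s, (1 - X ^ e i)))
    convert this using 1
    ring

theorem X_pow_dvd_evenProd_sub {k n : ℕ} (h : k ≤ n) :
    (X : K⟦X⟧) ^ (2 * (k + 1)) ∣ evenProd K n - evenProd K k := by
  have := X_pow_dvd_prod_one_sub (K := K) (Finset.Ico k n) (fun i => 2 * (i + 1)) (2 * (k + 1))
    fun i hi => by have := (Finset.mem_Ico.mp hi).1; lia
  have h₂ := (dvd_neg.mpr this).mul_left (evenProd K k)
  convert h₂ using 1
  rw [evenProd, evenProd, ← Finset.prod_range_mul_prod_Ico _ h]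
  ring

/-- Both `evenProd K n` and `evenProd K l` agree with `evenProd K k` to this order, since `k` is the
smallest index. -/
theorem X_pow_dvd_one_sub_evenProd_sq_mul (n k l : ℕ) (hkl : k + l = 2 * n) (hk : k ≤ l) :
    (X : K⟦X⟧) ^ (2 * (k + 1)) ∣ evenProd K n ^ 2 * ((evenProd K k)⁻¹ * (evenProd K l)⁻¹) - 1 := by
  have h₁ := X_pow_dvd_evenProd_sub (K := K) (by lia : k ≤ n)
  have h₂ := X_pow_dvd_evenProd_sub (K := K) hk
  have hki := evenProd_mul_inv (K := K) k
  have hli := evenProd_mul_inv (K := K) l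
  have := (((h₁.mul_right (evenProd K n + evenProd K k)).sub
    (h₂.mul_right (evenProd K k)))).mul_right ((evenProd K k)⁻¹ * (evenProd K l)⁻¹)
  convert this using 1
  linear_combination evenProd K l * (evenProd K l)⁻¹ * hki + hli

theorem X_pow_dvd_term_sub (n : ℕ) {j : ℤ} (hj : j ∈ Finset.Icc (-(n : ℤ)) n) :
    (X : K⟦X⟧) ^ (2 * n + 1) ∣
      evenProd K n ^ 2 * term K n j - (-1) ^ j.natAbs * X ^ (j.natAbs ^ 2) := by
  rw [Finset.mem_Icc] at hj
  have key : (X : K⟦X⟧) ^ (2 * (n - j.natAbs + 1)) ∣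
      evenProd K n ^ 2 * (invEven K (n + j) * invEven K (n - j)) - 1 := by
    rcases le_total 0 j with h | h
    · obtain ⟨m, rfl⟩ := Int.eq_ofNat_of_zero_le h
      have := X_pow_dvd_one_sub_evenProd_sq_mul (K := K) n (n - m) (n + m) (by lia) (by lia)
      rw [← invEven_natCast, ← invEven_natCast, mul_comm (invEven K _)] at this
      rw [Int.natAbs_natCast]
      convert this using 5
      · lia
      · lia
    · obtain ⟨m, rfl⟩ := Int.exists_eq_neg_ofNat h
      have := X_pow_dvd_one_sub_evenProd_sq_mul (K := K) n (n - m) (n + m) (by lia) (by lia)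
      rw [← invEven_natCast, ← invEven_natCast] at this
      rw [Int.natAbs_neg, Int.natAbs_natCast]
      convert this using 5
      · lia
      · lia
  have h₂ : (X : K⟦X⟧) ^ (2 * n + 1) ∣ X ^ (j.natAbs ^ 2) * X ^ (2 * (n - j.natAbs + 1)) := by
    rw [← pow_add]
    refine pow_dvd_pow _ ?_
    obtain ⟨d, hd⟩ := Nat.exists_eq_add_of_le (by lia : j.natAbs ≤ n)
    rw [hd, Nat.add_sub_cancel_left]
    -- The exponent `j^2 + 2(n-|j|+1)` equals `2n+1 + (|j|-1)^2`.
    nlinarith [sq_nonneg ((j.natAbs : ℤ) - 1)]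
  have h₃ := (h₂.trans (mul_dvd_mul_left _ key)).mul_left ((-1) ^ j.natAbs)
  convert h₃ using 1
  rw [term]
  ring

theorem X_pow_dvd_finsum_sub (n : ℕ) :
    (X : K⟦X⟧) ^ (2 * n + 1) ∣ evenProd K n ^ 2 * (∑ᶠ j, term K n j) - thetaSum K n := by
  rw [finsum_eq_sum_of_support_subset (s := Finset.Icc (-(n : ℤ)) n) _ (fun j hj => by
    by_contra h
    exact hj (term_eq_zero (by simpa using h))), thetaSum, Finset.mul_sum,
    ← Finset.sum_sub_distrib]
  exact Finset.dvd_sum fun j hj => X_pow_dvd_term_sub n hj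

/-- Gauss' identity `∑ (-1)^j q^(j²) = ∏ (1 - q^k) / (1 + q^k)`, up to order `2n`. -/
theorem X_pow_dvd_thetaSum_mul_plusProd_sub (n : ℕ) :
    (X : K⟦X⟧) ^ (2 * n + 1) ∣ thetaSum K n * plusProd K (2 * n) - fullProd K (2 * n) := by
  have h₁ := X_pow_dvd_finsum_sub (K := K) n
  have h₂ : (X : K⟦X⟧) ^ (2 * n + 1) ∣ evenProd K (2 * n) - evenProd K n :=
    (pow_dvd_pow _ (by lia)).trans (X_pow_dvd_evenProd_sub (by lia))
  have h₃ := finsum_term_mul_evenProd (K := K) n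
  have h₄ := evenProd_mul_oddProd (K := K) n
  have h₅ := fullProd_mul_plusProd (K := K) (2 * n)
  have hi := evenProd_mul_inv (K := K) (2 * n)
  have h₆ := ((h₁.mul_right (evenProd K (2 * n)))).mul_right
    (plusProd K (2 * n) * (evenProd K (2 * n))⁻¹)
  -- Exact before truncation: with `(q^2;q^2)_n (q;q^2)_n = (q;q)_(2n)`, the finite identity gives
  -- `(q;q)_(2n)^2` times `plusProd`.
  have h₇ : evenProd K n ^ 2 * (∑ᶠ j, term K n j) * evenProd K (2 * n) * plusProd K (2 * n) =
      fullProd K (2 * n) * evenProd K (2 * n) := by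
    linear_combination evenProd K n ^ 2 * plusProd K (2 * n) * h₃ +
      plusProd K (2 * n) * (evenProd K n * oddProd K n + fullProd K (2 * n)) * h₄ +
      fullProd K (2 * n) * h₅
  rw [← dvd_neg]
  convert h₆ using 1
  linear_combination -(evenProd K (2 * n))⁻¹ * h₇ +
    (thetaSum K n * plusProd K (2 * n) - fullProd K (2 * n)) * hi

theorem X_pow_dvd_of_mul_eq (n : ℕ) (f : K⟦X⟧)
    (h : f * plusProd K (2 * n) ^ 2 = fullProd K (2 * n) ^ 2) :
    (X : K⟦X⟧) ^ (2 * n + 1) ∣ thetaSum K n ^ 2 - f := by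
  have hi : plusProd K (2 * n) * (plusProd K (2 * n))⁻¹ = 1 :=
    PowerSeries.mul_inv_cancel _ (by simp [constantCoeff_plusProd])
  have := ((X_pow_dvd_thetaSum_mul_plusProd_sub (K := K) n).mul_right
    (thetaSum K n * plusProd K (2 * n) + fullProd K (2 * n))).mul_right
    ((plusProd K (2 * n))⁻¹ ^ 2)
  convert this using 1
  linear_combination (-(plusProd K (2 * n))⁻¹ ^ 2) * h -
    (thetaSum K n ^ 2 - f) * (plusProd K (2 * n) * (plusProd K (2 * n))⁻¹ + 1) * hi

theorem coeff_thetaSum_sq {n d : ℕ} (h : d ≤ n) :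
    coeff d (thetaSum K n ^ 2) =
      (-1) ^ d * (Set.ncard {p : ℤ × ℤ | (d : ℤ) = p.1 ^ 2 + p.2 ^ 2} : K) := by
  have hset : {p : ℤ × ℤ | (d : ℤ) = p.1 ^ 2 + p.2 ^ 2} =
      ((Finset.Icc (-(n : ℤ)) n ×ˢ Finset.Icc (-(n : ℤ)) n).filter
        fun p => d = p.1.natAbs ^ 2 + p.2.natAbs ^ 2 : Finset (ℤ × ℤ)) := by
    ext ⟨r, s⟩
    have hrs : d = r.natAbs ^ 2 + s.natAbs ^ 2 ↔ (d : ℤ) = r ^ 2 + s ^ 2 := by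
      zify; rw [sq_abs, sq_abs]
    simp only [Set.mem_ofPred_eq, Finset.coe_filter, Finset.mem_product, Finset.mem_Icc, hrs]
    -- The bounds `|r|, |s| ≤ n` follow from `r^2 + s^2 = d ≤ n`, so the truncated sum misses no
    -- representation.
    refine ⟨fun h' => ⟨?_, h'⟩, fun h' => h'.2⟩
    have hd : (d : ℤ) ≤ n := by exact_mod_cast h
    refine ⟨⟨?_, ?_⟩, ?_, ?_⟩ <;> nlinarith [sq_nonneg r, sq_nonneg s]
  rw [hset, Set.ncard_coe_finset, sq, thetaSum, Finset.sum_mul_sum, ← Finset.sum_product',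
    map_sum, Finset.card_filter, Nat.cast_sum, Finset.mul_sum]
  refine Finset.sum_congr rfl fun p _ => ?_
  have hp : (-1 : K⟦X⟧) ^ p.1.natAbs * X ^ (p.1.natAbs ^ 2) *
      ((-1) ^ p.2.natAbs * X ^ (p.2.natAbs ^ 2)) =
      C ((-1) ^ (p.1.natAbs + p.2.natAbs)) * X ^ (p.1.natAbs ^ 2 + p.2.natAbs ^ 2) := by
    simp only [map_pow, map_neg, map_one]
    ring
  rw [hp, coeff_C_mul, coeff_X_pow]
  split_ifs with hd
  · rw [hd]
    congr 1
    -- Squaring preserves parity, so `r + s` and `r^2 + s^2` give the same sign.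
    · rw [neg_one_pow_congr]
      simp [Nat.even_add, Nat.even_pow]
    · simp
  · simp

end GaussSquare

/-! ### Reduction modulo 5 and the conclusion. -/

namespace MacMahonSums

open GaussSquare

theorem one_add_factor_two_mul (i : ℕ) :
    PowerSeries.map (Int.castRingHom (ZMod 5)) (1 + factor 2 i.succPNat) *
      (1 + PowerSeries.X ^ (i + 1)) ^ 2 = (1 - PowerSeries.X ^ (i + 1)) ^ 2 := by
  have h := congrArg (PowerSeries.map (Int.castRingHom (ZMod 5)))
    (factor_mul_denom 2 i.succPNat)
  have h5 : (5 : (ZMod 5)⟦X⟧) = 0 := by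
    rw [← map_ofNat (PowerSeries.C (R := ZMod 5)) 5, show (OfNat.ofNat 5 : ZMod 5) = 0 from rfl,
      map_zero]
  simp only [denom, map_mul, map_add, map_pow, map_one, PowerSeries.map_X,
    Nat.succPNat_coe, Nat.succ_eq_add_one, map_ofNat] at h ⊢
  linear_combination h + PowerSeries.X ^ (i + 1) * h5

-- Primality of 5 makes `ZMod 5` a field, as `plusProd` and `fullProd` require.
theorem map_prod_one_add_factor_two_mul [Fact (Nat.Prime 5)] (n : ℕ) :
    PowerSeries.map (Int.castRingHom (ZMod 5))
      (∏ i ∈ Finset.range n, (1 + factor 2 i.succPNat)) * plusProd (ZMod 5) n ^ 2 =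
      fullProd (ZMod 5) n ^ 2 := by
  rw [plusProd, fullProd, map_prod, ← Finset.prod_pow, ← Finset.prod_pow,
    ← Finset.prod_mul_distrib]
  exact Finset.prod_congr rfl fun i _ => one_add_factor_two_mul i

end MacMahonSums

theorem theorem5p4 :
    (∀ t : ℕ, Summable fun S : {S : Finset ℕ+ // S.card = t} => MacMahonSums.summand 2 S.1) ∧
    (Summable fun t : ℕ => MacMahonSums.U 2 t) ∧
    ∀ y : ℕ → ℤ, HasSum (fun t : ℕ => MacMahonSums.U 2 t) (PowerSeries.mk y) →
      ∀ n : ℕ,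
        y n ≡ (-1) ^ n * (Set.ncard {p : ℤ × ℤ | (n : ℤ) = p.1 ^ 2 + p.2 ^ 2} : ℤ) [ZMOD 5] := by
  refine ⟨MacMahonSums.summable_summand_card 2, (MacMahonSums.hasSum_U 2).summable,
    fun y hy n => ?_⟩
  obtain ⟨N, hN⟩ := Filter.eventually_atTop.mp
    (MacMahonSums.eventually_coeff_prod_one_add_factor 2 n)
  rw [(MacMahonSums.hasSum_U 2).unique hy] at hN
  -- `N ≤ M` makes the `n`-th coefficient of the partial product stable; `n ≤ M` keeps `n` within
  -- the range of the truncated theta identity.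
  obtain ⟨M, hNM, hnM⟩ : ∃ M, N ≤ M ∧ n ≤ M := ⟨max N n, le_max_left _ _, le_max_right _ _⟩
  have hM := hN (2 * M) (by lia)
  have : Fact (Nat.Prime 5) := ⟨by norm_num⟩
  have h := PowerSeries.X_pow_dvd_iff.mp (GaussSquare.X_pow_dvd_of_mul_eq M _
    (MacMahonSums.map_prod_one_add_factor_two_mul (2 * M))) n (by lia)
  rw [map_sub, GaussSquare.coeff_thetaSum_sq (by lia), PowerSeries.coeff_map, hM,
    PowerSeries.coeff_mk, sub_eq_zero] at h
  refine (ZMod.intCast_eq_intCast_iff _ _ 5).mp ?_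
  push_cast
  exact h.symm
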